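/- **Proposition 5.3.** Let $m\ge 2$ and $n\ge m+1$ be integers, and let $A_1,\dots,A_{m-1}$ be real $(n+1)\times(n+1)$ matrices with $$A_pA_q+A_qA_p=-2\delta_{pq}I,\qquad A_p^{T}=-A_p\qquad(1\le p,q\le m-1).$$ Put $$F(x,y)=\langle x,y\rangle^2+\sum_{q=1}^{m-1}\langle A_qx,y\rangle^2\qquad (x,y\in\mathbb R^{n+1}),$$ and let $$\Sigma=\Big\{(x,y)\in\mathbb S^n(1)\times\mathbb S^n(1):\ F(x,y)=\tfrac{m-1}{n-1}\Big\}$$ be the minimal FKM isoparametric hypersurface of $\mathbb S^n(1)\times\mathbb S^n(1)$. Then $\frac1{\sqrt2}\Sigma$ is a smooth embedded submanifold of codimension two of the unit sphere $\mathbb S^{2n+1}(1)\subset\mathbb R^{2n+2}$ (that is, it is contained in $\mathbb S^{2n+1}(1)$ and is a smooth embedded submanifold of codimension three of $\mathbb R^{2n+2}$). Let $\widetilde B$ be its second fundamental form in $\mathbb S^{2n+1}(1)$. For a unit vector $\nu$ normal to $\frac1{\sqrt2}\Sigma$ and tangent to $\mathbb S^{2n+1}(1)$ at a point of $\frac1{\sqrt2}\Sigma$,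 let $\widetilde B^{\nu}(X,Y)=\langle\widetilde B(X,Y),\nu\rangle$, and let $\|\widetilde B^\nu\|^2=\sum_{i,j}\widetilde B^\nu(e_i,e_j)^2$ for an orthonormal basis $(e_i)$ of the tangent space of $\frac1{\sqrt2}\Sigma$ at that point. Then $$\alpha^2:=\sup_{\nu}\|\widetilde B^{\nu}\|^2=6(n-1),$$ where the supremum is over all such $\nu$ at all points of $\frac1{\sqrt2}\Sigma$. -/

import Mathlib

open scoped ContDiff Pointwise Topology

noncomputable section

namespace FKM

section Submanifolds

variable {E : Type*} [NormedAddCommGroup E] [InnerProductSpace ℝ E] [FiniteDimensional ℝ E]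

/-- `M` is a smooth embedded submanifold of codimension `d` of the Euclidean space `E`: around each
of its points it is the zero set of a smooth submersion onto `ℝ^d`. -/
def IsSubmanifoldOfCodim (d : ℕ) (M : Set E) : Prop :=
  ∀ p ∈ M, ∃ (U : Set E) (g : E → EuclideanSpace ℝ (Fin d)),
    IsOpen U ∧ p ∈ U ∧ ContDiffOn ℝ ∞ g U ∧
      (∀ q ∈ U, Function.Surjective (fderiv ℝ g q)) ∧ M ∩ U = {q ∈ U | g q = 0}

/-- The velocities at `p` of smooth curves in `M` through `p`. -/
def velocities (M : Set E) (p : E) : Set E :=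
  {v | ∃ γ : ℝ → E, ContDiffAt ℝ ∞ γ 0 ∧ (∀ᶠ t in 𝓝 (0 : ℝ), γ t ∈ M) ∧ γ 0 = p ∧ deriv γ 0 = v}

/-- The tangent space `T_p M`. For a submanifold `M` the velocities already form a linear subspace,
so that taking the span adds nothing. -/
def tangentSpaceAt (M : Set E) (p : E) : Submodule ℝ E :=
  Submodule.span ℝ (velocities M p)

/-- The normal space at `p` of `M` as a submanifold of `N`. -/
def normalSpaceAt (N M : Set E) (p : E) : Submodule ℝ E :=
  (tangentSpaceAt M p)ᗮ ⊓ tangentSpaceAt N p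

/-- The Levi-Civita connection of the submanifold `N` of `E`, applied to a vector field `Y` that is
given along the submanifold `M` of `N`, in the direction of a vector `X` tangent to `M` at `p`: the
tangential part of the directional derivative. (Derivatives within `M` are uniquely determined on
vectors tangent to `M`.) -/
def covariantDeriv (N M : Set E) (p X : E) (Y : E → E) : E :=
  (tangentSpaceAt N p).starProjection (fderivWithin ℝ Y M p X)

/-- The extension of `Y ∈ T_p M` to a tangent vector field along `M` by orthogonal projection. -/
def tangentExtension (M : Set E) (Y : E) : E → E :=
  fun q => (tangentSpaceAt M q).starProjection Y

/-- The second fundamental form `B(X, Y) = (∇_X Y)^⊥` at `p` of `M` as a submanifold of `N`, for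
`X`, `Y` in `T_p M`; `∇` is the Levi-Civita connection of `N`. As usual the value does not depend on
how `Y` is extended to a tangent vector field of `M`. -/
def secondFundamentalForm (N M : Set E) (p X Y : E) : E :=
  (normalSpaceAt N M p).starProjection (covariantDeriv N M p X (tangentExtension M Y))

/-- `‖B^ν‖²`, where `B^ν(X, Y) = ⟨B(X, Y), ν⟩`: the sum of the squares of the entries of `B^ν` in an
orthonormal basis of `T_p M`. -/
def sffNormSq (N M : Set E) (p ν : E) : ℝ :=
  let b := stdOrthonormalBasis ℝ (tangentSpaceAt M p)
  ∑ i, ∑ j, (inner ℝ (secondFundamentalForm N M p (b i : E) (b j : E)) ν) ^ 2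

/-- All the values `‖B^ν‖²`, where `ν` runs through the unit normal bundle of `M` in `N`. -/
def sffNormSqValues (N M : Set E) : Set ℝ :=
  {r | ∃ p ∈ M, ∃ ν ∈ normalSpaceAt N M p, ‖ν‖ = 1 ∧ r = sffNormSq N M p ν}

end Submanifolds

/-- `ℝ^{n+1}` with its Euclidean structure. -/
abbrev V (n : ℕ) : Type := EuclideanSpace ℝ (Fin (n + 1))

/-- `ℝ^{2n+2} = ℝ^{n+1} × ℝ^{n+1}` with its Euclidean structure. -/
abbrev W (n : ℕ) : Type := WithLp 2 (V n × V n)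

/-- `A_p A_q + A_q A_p = -2 δ_{pq} I` and `A_pᵀ = -A_p`: a skew-symmetric representation of the
Clifford algebra with `r` generators on `ℝ^{n+1}`. -/
structure IsSkewCliffordSystem {n r : ℕ} (A : Fin r → V n →L[ℝ] V n) : Prop where
  anticomm : ∀ p q, (A p).comp (A q) + (A q).comp (A p) =
    if p = q then (-2 : ℝ) • ContinuousLinearMap.id ℝ (V n) else 0
  skew : ∀ p, ContinuousLinearMap.adjoint (A p) = -A p

/-- The splitting form `F(x, y) = ⟨x, y⟩² + ∑_q ⟨A_q x, y⟩²`. -/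
def splittingForm {n r : ℕ} (A : Fin r → V n →L[ℝ] V n) (z : W n) : ℝ :=
  (inner ℝ z.fst z.snd) ^ 2 + ∑ q, (inner ℝ (A q z.fst) z.snd) ^ 2

/-- The level set of `F` in `S^n(1) × S^n(1)` at the level `c`. -/
def levelSet {n r : ℕ} (A : Fin r → V n →L[ℝ] V n) (c : ℝ) : Set (W n) :=
  {z | ‖z.fst‖ = 1 ∧ ‖z.snd‖ = 1 ∧ splittingForm A z = c}

/-- The minimal FKM isoparametric hypersurface `Σ = F⁻¹((m-1)/(n-1))` in `S^n(1) × S^n(1)`. -/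
def minimalFKM {n m : ℕ} (A : Fin (m - 1) → V n →L[ℝ] V n) : Set (W n) :=
  levelSet A (((m : ℝ) - 1) / ((n : ℝ) - 1))

/-- `(1/√2) Σ`. -/
def scaledMinimalFKM {n m : ℕ} (A : Fin (m - 1) → V n →L[ℝ] V n) : Set (W n) :=
  (1 / Real.sqrt 2) • minimalFKM A

/-- The unit sphere `S^{2n+1}(1)` in `ℝ^{2n+2}`. -/
def unitSphere (n : ℕ) : Set (W n) := Metric.sphere 0 1

end FKM

end

namespace FKM

section Tangent

variable {E : Type*} [NormedAddCommGroup E] [InnerProductSpace ℝ E]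

/-- Two derivatives within `M` agree on vectors tangent to `M`. -/
theorem hasFDerivWithinAt_eq_on_tangentSpaceAt {F : Type*} [NormedAddCommGroup F]
    [NormedSpace ℝ F] {M : Set E} {p : E} {Y : E → F} {Y₁ Y₂ : E →L[ℝ] F}
    (h₁ : HasFDerivWithinAt Y Y₁ M p) (h₂ : HasFDerivWithinAt Y Y₂ M p) {X : E}
    (hX : X ∈ tangentSpaceAt M p) : Y₁ X = Y₂ X := by
  have hle : tangentSpaceAt M p ≤ LinearMap.ker ((Y₁ - Y₂ : E →L[ℝ] F) : E →ₗ[ℝ] F) := by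
    refine Submodule.span_le.2 ?_
    rintro w ⟨γ, hγ, hγM, hγ0, hγ'⟩
    have h1 : HasDerivAt γ w 0 := hγ' ▸ (hγ.differentiableAt (by simp)).hasDerivAt
    let S : Set ℝ := {t | γ t ∈ M}
    have hS : S ∈ 𝓝 (0 : ℝ) := hγM
    have key : ∀ Z : E →L[ℝ] F, HasFDerivWithinAt Y Z M p → HasDerivAt (Y ∘ γ) (Z w) 0 := by
      intro Z hZ
      have hZ' : HasFDerivWithinAt Y Z M (γ 0) := by rwa [hγ0]
      exact (hZ'.comp_hasDerivWithinAt (0 : ℝ) (s := S) h1.hasDerivWithinAt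
        (fun t ht => ht)).hasDerivAt hS
    have := (key Y₁ h₁).unique (key Y₂ h₂)
    simp [this]
  have := hle hX
  simpa [sub_eq_zero] using this

end Tangent

section Submanifolds

variable {E : Type*} [NormedAddCommGroup E] [InnerProductSpace ℝ E] [FiniteDimensional ℝ E]

theorem isOpen_setOf_surjective {G F : Type*} [NormedAddCommGroup G] [NormedSpace ℝ G]
    [FiniteDimensional ℝ G] [NormedAddCommGroup F] [NormedSpace ℝ F] [FiniteDimensional ℝ F] :
    IsOpen {f : G →L[ℝ] F | Function.Surjective f} := by
  have : CompleteSpace F := FiniteDimensional.complete ℝ F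
  rw [isOpen_iff_mem_nhds]
  intro f hf
  obtain ⟨R, hR⟩ := (f : G →ₗ[ℝ] F).exists_rightInverse_of_surjective (LinearMap.range_eq_top.2 hf)
  let R' : F →L[ℝ] G := LinearMap.toContinuousLinearMap R
  have hcont : Continuous fun h : G →L[ℝ] F => h.comp R' := by fun_prop
  have hfR : f.comp R' = 1 := by
    ext v
    exact LinearMap.congr_fun hR v
  have hmem : {u : F →L[ℝ] F | IsUnit u} ∈ 𝓝 (f.comp R') := by
    rw [hfR]
    exact Units.isOpen.mem_nhds isUnit_one
  filter_upwards [hcont.continuousAt.preimage_mem_nhds hmem] with h hh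
  obtain ⟨u, hu⟩ := hh
  intro y
  refine ⟨R' ((↑u⁻¹ : F →L[ℝ] F) y), ?_⟩
  have h1 : h (R' ((↑u⁻¹ : F →L[ℝ] F) y)) = (↑u : F →L[ℝ] F) ((↑u⁻¹ : F →L[ℝ] F) y) := by
    rw [hu]; rfl
  rw [h1]
  exact DFunLike.congr_fun u.mul_inv y

/-- Every vector in the kernel of the differential of a smooth submersion is the velocity of a
smooth curve in the zero set. -/
theorem mem_velocities_of_fderiv_eq_zero {F : Type*} [NormedAddCommGroup F] [NormedSpace ℝ F]
    [FiniteDimensional ℝ F] {M : Set E} {g : E → F} {p : E} (hg : ContDiffAt ℝ ∞ g p)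
    (hs : Function.Surjective (fderiv ℝ g p)) (hM : ∀ᶠ q in 𝓝 p, g q = 0 → q ∈ M) (hp : g p = 0)
    {v : E} (hv : fderiv ℝ g p v = 0) : v ∈ velocities M p := by
  have : CompleteSpace E := FiniteDimensional.complete ℝ E
  set g' := fderiv ℝ g p with hg'
  obtain ⟨R₀, hR₀⟩ :=
    (g' : E →ₗ[ℝ] F).exists_rightInverse_of_surjective (LinearMap.range_eq_top.2 hs)
  let R : F →L[ℝ] E := LinearMap.toContinuousLinearMap R₀
  have hR : ∀ w, g' (R w) = w := fun w => LinearMap.congr_fun hR₀ w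
  let Φ : E → E := fun q => (q - p) - R (g' (q - p)) + R (g q)
  have hgd : HasFDerivAt g g' p := (hg.differentiableAt (by simp)).hasFDerivAt
  have hΦ : ContDiffAt ℝ ∞ Φ p := by
    refine ContDiffAt.add (ContDiffAt.sub ?_ ?_) ?_
    · fun_prop
    · fun_prop
    · exact R.contDiff.contDiffAt.comp p hg
  have hΦ' : HasFDerivAt Φ ((ContinuousLinearEquiv.refl ℝ E : E ≃L[ℝ] E) : E →L[ℝ] E) p := by
    have h1 : HasFDerivAt (fun q : E => q - p) (ContinuousLinearMap.id ℝ E) p :=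
      (hasFDerivAt_id p).sub_const p
    have h2 := (R.comp g').hasFDerivAt.comp p h1
    have h3 := R.hasFDerivAt.comp p hgd
    have h4 : ContinuousLinearMap.id ℝ E - (R.comp g').comp (ContinuousLinearMap.id ℝ E)
        + R.comp g' = ((ContinuousLinearEquiv.refl ℝ E : E ≃L[ℝ] E) : E →L[ℝ] E) := by
      ext w
      simp
    rw [← h4]
    exact (h1.sub h2).add h3
  have hΦp : Φ p = 0 := by simp [Φ, hp]
  have hne : (∞ : WithTop ℕ∞) ≠ 0 := by simp
  let ψ := hΦ.localInverse hΦ' hne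
  have hψ0 : ψ 0 = p := by
    have := hΦ.localInverse_apply_image hΦ' hne
    rwa [hΦp] at this
  have hψ : ContDiffAt ℝ ∞ ψ 0 := by
    have := hΦ.to_localInverse hΦ' hne
    rwa [hΦp] at this
  have hright : ∀ᶠ w in 𝓝 (0 : E), Φ (ψ w) = w := by
    have := (hΦ.hasStrictFDerivAt' hΦ' hne).eventually_right_inverse
    rwa [hΦp] at this
  have hψd : HasFDerivAt ψ (ContinuousLinearMap.id ℝ E) 0 := by
    have := (hΦ.hasStrictFDerivAt' hΦ' hne).to_localInverse.hasFDerivAt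
    rw [hΦp] at this
    exact this
  have hline : HasDerivAt (fun t : ℝ => t • v) v 0 := by
    simpa using (hasDerivAt_id (0 : ℝ)).smul_const v
  have hline0 : Filter.Tendsto (fun t : ℝ => t • v) (𝓝 0) (𝓝 0) := by
    simpa using hline.continuousAt.tendsto
  refine ⟨fun t => ψ (t • v), ?_, ?_, by simp [hψ0], ?_⟩
  · have h1 : ContDiffAt ℝ ∞ (fun t : ℝ => t • v) 0 := by fun_prop
    have h2 : ContDiffAt ℝ ∞ ψ ((0 : ℝ) • v) := by rwa [zero_smul]
    exact h2.comp (0 : ℝ) h1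
  · have hψt : Filter.Tendsto (fun t : ℝ => ψ (t • v)) (𝓝 0) (𝓝 p) := by
      have := hψ.continuousAt.tendsto.comp hline0
      rwa [hψ0] at this
    filter_upwards [hline0.eventually hright, hψt.eventually hM] with t ht1 ht2
    apply ht2
    have h1 := congrArg g' ht1
    simp only [Φ, map_add, map_sub, hR, map_smul, hv, smul_zero] at h1
    simpa using h1
  · have h1 : HasFDerivAt ψ (ContinuousLinearMap.id ℝ E) ((0 : ℝ) • v) := by rwa [zero_smul]
    have h2 := h1.comp_hasDerivAt (0 : ℝ) hline
    exact h2.deriv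

/-- The tangent space of the zero set of a smooth submersion is the kernel of its differential. -/
theorem mem_tangentSpaceAt_iff {F : Type*} [NormedAddCommGroup F] [NormedSpace ℝ F]
    [FiniteDimensional ℝ F] {M : Set E} {g : E → F} {p : E} (hg : ContDiffAt ℝ ∞ g p)
    (hs : Function.Surjective (fderiv ℝ g p)) (hM : ∀ q, q ∈ M ↔ g q = 0) (hp : p ∈ M) {v : E} :
    v ∈ tangentSpaceAt M p ↔ fderiv ℝ g p v = 0 := by
  constructor
  · intro h
    have hle : tangentSpaceAt M p ≤ LinearMap.ker (fderiv ℝ g p : E →ₗ[ℝ] F) := by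
      refine Submodule.span_le.2 ?_
      rintro w ⟨γ, hγ, hγM, hγ0, hγ'⟩
      have h1 : HasDerivAt γ w 0 := hγ' ▸ (hγ.differentiableAt (by simp)).hasDerivAt
      have h2 : HasFDerivAt g (fderiv ℝ g p) (γ 0) := by
        rw [hγ0]
        exact (hg.differentiableAt (by simp)).hasFDerivAt
      have h3 := h2.comp_hasDerivAt (0 : ℝ) h1
      have h4 : (g ∘ γ) =ᶠ[𝓝 0] fun _ => 0 := by
        filter_upwards [hγM] with t ht using (hM _).1 ht
      have h5 := h4.deriv_eq
      rw [h3.deriv, deriv_const] at h5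
      exact h5
    exact hle h
  · intro h
    exact Submodule.subset_span (mem_velocities_of_fderiv_eq_zero hg hs
      (Filter.Eventually.of_forall fun q hq => (hM q).2 hq) ((hM p).1 hp) h)

theorem starProjection_orthogonal_span_orthonormal {k : ℕ} {n : Fin k → E} (hn : Orthonormal ℝ n)
    {T : Submodule ℝ E} (hT : T = (Submodule.span ℝ (Set.range n))ᗮ) (Y : E) :
    T.starProjection Y = Y - ∑ i, (inner ℝ (n i) Y) • n i := by
  subst hT
  apply Submodule.eq_starProjection_of_mem_of_inner_eq_zero
  · rw [Submodule.mem_orthogonal']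
    intro u hu
    induction hu using Submodule.span_induction with
    | mem x hx =>
      obtain ⟨j, rfl⟩ := hx
      simp [inner_sub_left, sum_inner, inner_smul_left, orthonormal_iff_ite.1 hn,
        real_inner_comm]
    | zero => simp
    | add x y _ _ hx hy => rw [inner_add_right, hx, hy, add_zero]
    | smul a x _ hx => rw [inner_smul_right, hx, mul_zero]
  · intro w hw
    rw [sub_sub_cancel, sum_inner]
    refine Finset.sum_eq_zero fun i _ => ?_
    rw [inner_smul_left, (Submodule.mem_orthogonal _ _).1 hw _
      (Submodule.subset_span ⟨i, rfl⟩), mul_zero]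

/-- The Weingarten formula, for a frame field of `E` that is orthonormal and normal along `M`. -/
theorem inner_secondFundamentalForm {k : ℕ} {N M : Set E} {n : Fin k → E → E} {p : E} (hp : p ∈ M)
    {n' : Fin k → E →L[ℝ] E} (hd : ∀ i, HasFDerivAt (n i) (n' i) p)
    (ho : ∀ q ∈ M, Orthonormal ℝ fun i => n i q)
    (hT : ∀ q ∈ M, tangentSpaceAt M q = (Submodule.span ℝ (Set.range fun i => n i q))ᗮ)
    {X Y ν : E} (hX : X ∈ tangentSpaceAt M p) (hY : Y ∈ tangentSpaceAt M p)
    (hν : ν ∈ normalSpaceAt N M p) :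
    inner ℝ (secondFundamentalForm N M p X Y) ν
      = -∑ i, inner ℝ (n i p) ν * inner ℝ (n' i X) Y := by
  have hnY : ∀ i, inner ℝ (n i p) Y = 0 := by
    intro i
    rw [hT p hp] at hY
    exact (Submodule.mem_orthogonal _ _).1 hY _ (Submodule.subset_span ⟨i, rfl⟩)
  have hext : HasFDerivAt (fun q => Y - ∑ i, (inner ℝ (n i q) Y) • n i q)
      (-∑ i, (inner ℝ (n i p) Y • n' i
        + ((innerSL ℝ Y).comp (n' i)).smulRight (n i p))) p := by
    have h1 : ∀ i ∈ (Finset.univ : Finset (Fin k)),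
        HasFDerivAt (fun q => (inner ℝ (n i q) Y) • n i q) (inner ℝ (n i p) Y • n' i
          + ((innerSL ℝ Y).comp (n' i)).smulRight (n i p)) p := by
      intro i _
      have h2 : HasFDerivAt (fun q => inner ℝ (n i q) Y) ((innerSL ℝ Y).comp (n' i)) p := by
        have := (innerSL ℝ Y).hasFDerivAt.comp p (hd i)
        refine this.congr_of_eventuallyEq (Filter.Eventually.of_forall fun q => ?_)
        simp [real_inner_comm]
      exact h2.smul (hd i)
    have h3 := (HasFDerivAt.fun_sum h1).const_sub Y
    exact h3
  have hwithin : HasFDerivWithinAt (tangentExtension M Y)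
      (-∑ i, (inner ℝ (n i p) Y • n' i
        + ((innerSL ℝ Y).comp (n' i)).smulRight (n i p))) M p := by
    refine hext.hasFDerivWithinAt.congr' (fun q hq => ?_) hp
    exact starProjection_orthogonal_span_orthonormal (ho q hq) (hT q hq) Y
  unfold secondFundamentalForm covariantDeriv
  rw [Submodule.inner_starProjection_left_eq_right,
    Submodule.starProjection_eq_self_iff.2 hν,
    Submodule.inner_starProjection_left_eq_right,
    Submodule.starProjection_eq_self_iff.2 hν.2,
    hasFDerivWithinAt_eq_on_tangentSpaceAt hwithin.differentiableWithinAt.hasFDerivWithinAt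
      hwithin hX]
  simp only [neg_apply, inner_neg_left, sum_apply,
    sum_inner]
  congr 1
  refine Finset.sum_congr rfl fun i _ => ?_
  simp [hnY i, inner_smul_left, real_inner_comm, mul_comm]

/-- The squared norm of the compression of a symmetric operator to the orthogonal complement of an
orthonormal family. -/
theorem sum_inner_sq_compression {k : ℕ} {κ : Type*} [Fintype κ] {n : Fin k → E}
    (hn : Orthonormal ℝ n) {T : Submodule ℝ E} (hT : T = (Submodule.span ℝ (Set.range n))ᗮ)
    (b : OrthonormalBasis κ ℝ T) {S : E →L[ℝ] E} (hS : ∀ v w, inner ℝ (S v) w = inner ℝ v (S w)) :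
    ∑ i, ∑ j, (inner ℝ (S (b i)) (b j : E)) ^ 2
      = LinearMap.trace ℝ E ((S.comp S : E →L[ℝ] E) : E →ₗ[ℝ] E) - 2 * ∑ i, ‖S (n i)‖ ^ 2
        + ∑ i, ∑ j, (inner ℝ (S (n i)) (n j)) ^ 2 := by
  classical
  let e : κ ⊕ Fin k → E := Sum.elim (fun i => (b i : E)) n
  have hbn : ∀ i j, inner ℝ (n i) (b j : E) = 0 := fun i j => by
    have h := (b j).2
    have h' : (b j : E) ∈ (Submodule.span ℝ (Set.range n))ᗮ := by rw [← hT]; exact h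
    exact (Submodule.mem_orthogonal _ _).1 h' _ (Submodule.subset_span ⟨i, rfl⟩)
  have hbb : ∀ i j, inner ℝ (b i : E) (b j : E) = if i = j then (1 : ℝ) else 0 := fun i j => by
    rw [← Submodule.coe_inner]
    exact orthonormal_iff_ite.1 b.orthonormal i j
  have he : Orthonormal ℝ e := by
    rw [orthonormal_iff_ite]
    rintro (i | i) (j | j)
    · simpa [e] using hbb i j
    · simpa [e, real_inner_comm] using hbn j i
    · simpa [e] using hbn i j
    · simpa [e] using orthonormal_iff_ite.1 hn i j
  have hsp : ⊤ ≤ Submodule.span ℝ (Set.range e) := by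
    have h1 : Submodule.span ℝ (Set.range n) ≤ Submodule.span ℝ (Set.range e) :=
      Submodule.span_mono (by rintro _ ⟨i, rfl⟩; exact ⟨Sum.inr i, rfl⟩)
    have h2 : T ≤ Submodule.span ℝ (Set.range e) := by
      intro t ht
      have h3 := congrArg (Subtype.val) (b.sum_repr ⟨t, ht⟩)
      simp only [Submodule.coe_sum, Submodule.coe_smul] at h3
      rw [← h3]
      exact Submodule.sum_mem _ fun i _ => Submodule.smul_mem _ _
        (Submodule.subset_span ⟨Sum.inl i, rfl⟩)
    rw [← Submodule.sup_orthogonal_of_hasOrthogonalProjection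
      (K := Submodule.span ℝ (Set.range n)), ← hT]
    exact sup_le h1 h2
  let B := OrthonormalBasis.mk he hsp
  have hBl : ∀ i, B (Sum.inl i) = b i := fun i => by simp [B, e]
  have hBr : ∀ i, B (Sum.inr i) = n i := fun i => by simp [B, e]
  have parseval : ∀ v : E,
      ‖v‖ ^ 2 = ∑ j, (inner ℝ v (b j : E)) ^ 2 + ∑ j, (inner ℝ v (n j)) ^ 2 := by
    intro v
    have h := B.sum_sq_norm_inner_left v
    rw [← h, Fintype.sum_sum_type]
    simp [hBl, hBr]
  have htr : LinearMap.trace ℝ E ((S.comp S : E →L[ℝ] E) : E →ₗ[ℝ] E)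
      = ∑ i, ‖S (b i)‖ ^ 2 + ∑ i, ‖S (n i)‖ ^ 2 := by
    rw [LinearMap.trace_eq_sum_inner _ B, Fintype.sum_sum_type]
    simp [hBl, hBr, ← hS]
  have h1 : ∀ i, ∑ j, (inner ℝ (S (b i)) (b j : E)) ^ 2
      = ‖S (b i)‖ ^ 2 - ∑ j, (inner ℝ (S (b i)) (n j)) ^ 2 := fun i => by
    rw [parseval (S (b i))]; ring
  have h2 : ∀ i, ∑ j, (inner ℝ (S (n i)) (b j : E)) ^ 2
      = ‖S (n i)‖ ^ 2 - ∑ j, (inner ℝ (S (n i)) (n j)) ^ 2 := fun i => by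
    rw [parseval (S (n i))]; ring
  have h3 : ∑ i, ∑ j, (inner ℝ (S (b i)) (n j)) ^ 2
      = ∑ j, ∑ i, (inner ℝ (S (n j)) (b i : E)) ^ 2 := by
    rw [Finset.sum_comm]
    refine Finset.sum_congr rfl fun j _ => Finset.sum_congr rfl fun i _ => ?_
    rw [hS, real_inner_comm]
  simp only [h1, Finset.sum_sub_distrib, h3, h2, htr]
  ring

end Submanifolds

section CliffordSystem

variable {E : Type*} [NormedAddCommGroup E] [InnerProductSpace ℝ E] {ι : Type*}

/-- A symmetric Clifford system `(D, L_i)` on a Euclidean space with a distinguished member `D`. -/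
structure IsSymmCliffordSystem [DecidableEq ι] (D : E →L[ℝ] E) (L : ι → E →L[ℝ] E) : Prop where
  symm_head : ∀ v w, inner ℝ (D v) w = inner ℝ v (D w)
  symm : ∀ i v w, inner ℝ (L i v) w = inner ℝ v (L i w)
  sq_head : ∀ v, D (D v) = v
  anticomm_head : ∀ i v, D (L i v) = -L i (D v)
  anticomm : ∀ i j v, L i (L j v) + L j (L i v) = if i = j then (2 : ℝ) • v else 0

namespace IsSymmCliffordSystem

variable [DecidableEq ι] {D : E →L[ℝ] E} {L : ι → E →L[ℝ] E}

theorem apply_apply_self (h : IsSymmCliffordSystem D L) (i : ι) (v : E) : L i (L i v) = v := by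
  have := h.anticomm i i v
  rw [if_pos rfl, ← two_smul ℝ] at this
  exact smul_right_injective E (two_ne_zero (α := ℝ)) this

theorem inner_apply_apply (h : IsSymmCliffordSystem D L) (i j : ι) (v : E) :
    inner ℝ (L i v) (L j v) = if i = j then ‖v‖ ^ 2 else 0 := by
  have h1 := congrArg (fun w => inner ℝ w v) (h.anticomm i j v)
  simp only [inner_add_left, h.symm i (L j v), h.symm j (L i v)] at h1
  rw [real_inner_comm (L i v) (L j v)] at h1
  split_ifs at h1 ⊢ with hij
  · rw [inner_smul_left, real_inner_self_eq_norm_sq] at h1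
    simp only [conj_trivial] at h1
    linarith
  · rw [inner_zero_left] at h1
    linarith

theorem inner_head_apply (h : IsSymmCliffordSystem D L) (i : ι) (v : E) :
    inner ℝ (D v) (L i v) = 0 := by
  have h1 : inner ℝ (D v) (L i v) = inner ℝ v (D (L i v)) := h.symm_head _ _
  rw [h.anticomm_head, inner_neg_right, ← h.symm i v (D v), real_inner_comm (D v)] at h1
  linarith

theorem inner_head_head (h : IsSymmCliffordSystem D L) (v w : E) :
    inner ℝ (D v) (D w) = inner ℝ v w := by
  rw [h.symm_head, h.sq_head]

end IsSymmCliffordSystem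

theorem trace_eq_zero_of_anticomm {R S : E →L[ℝ] E} (hS : ∀ v, S (S v) = v)
    (hRS : ∀ v, R (S v) = -S (R v)) : LinearMap.trace ℝ E (R : E →ₗ[ℝ] E) = 0 := by
  have h1 : (R : E →ₗ[ℝ] E) = -((S : E →ₗ[ℝ] E) * ((R : E →ₗ[ℝ] E) * (S : E →ₗ[ℝ] E))) := by
    ext v
    simp [hRS, hS]
  have h2 := congrArg (LinearMap.trace ℝ E) h1
  rw [map_neg, LinearMap.trace_mul_comm, mul_assoc] at h2
  have h3 : (S : E →ₗ[ℝ] E) * (S : E →ₗ[ℝ] E) = 1 := by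
    ext v
    simp [hS]
  rw [h3, mul_one] at h2
  linarith

variable [Fintype ι]

/-- The coefficients `u_i(q) = ⟨L_i q, q⟩ / 2`. -/
noncomputable def cliffordCoeff (L : ι → E →L[ℝ] E) (q : E) (i : ι) : ℝ := inner ℝ (L i q) q / 2

/-- The quartic form `∑ u_i²`. -/
noncomputable def cliffordForm (L : ι → E →L[ℝ] E) (q : E) : ℝ := ∑ i, cliffordCoeff L q i ^ 2

/-- The operator `∑ u_i(q) L_i`. -/
noncomputable def cliffordOp (L : ι → E →L[ℝ] E) (q : E) : E →L[ℝ] E := ∑ i, cliffordCoeff L q i • L i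

/-- Half of the gradient of the form `∑ u_i²`. -/
noncomputable def cliffordGrad (L : ι → E →L[ℝ] E) (q : E) : E := cliffordOp L q q

/-- The differential of `cliffordGrad`. -/
noncomputable def cliffordHess (L : ι → E →L[ℝ] E) (q : E) : E →L[ℝ] E :=
  ∑ i, (innerSL ℝ (L i q)).smulRight (L i q) + cliffordOp L q

/-- The level set of `∑ u_i²` in the submanifold `‖q‖ = 1`, `⟨D q, q⟩ = 0`. -/
noncomputable def cliffordLevelSet (D : E →L[ℝ] E) (L : ι → E →L[ℝ] E) (f : ℝ) : Set E :=
  {q | ‖q‖ ^ 2 = 1 ∧ inner ℝ (D q) q = 0 ∧ cliffordForm L q = f}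

theorem cliffordOp_apply (L : ι → E →L[ℝ] E) (q v : E) :
    cliffordOp L q v = ∑ i, cliffordCoeff L q i • L i v := by
  simp [cliffordOp]

theorem cliffordHess_apply (L : ι → E →L[ℝ] E) (q v : E) :
    cliffordHess L q v = ∑ i, inner ℝ (L i q) v • L i q + cliffordOp L q v := by
  simp [cliffordHess]

theorem cliffordHess_self (L : ι → E →L[ℝ] E) (q : E) :
    cliffordHess L q q = (3 : ℝ) • cliffordGrad L q := by
  have h1 : ∑ i, inner ℝ (L i q) q • L i q = (2 : ℝ) • cliffordOp L q q := by
    rw [cliffordOp_apply, Finset.smul_sum]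
    refine Finset.sum_congr rfl fun i _ => ?_
    rw [smul_smul, cliffordCoeff, mul_div_cancel₀ _ two_ne_zero]
  rw [cliffordHess_apply, h1, cliffordGrad]
  module

variable [DecidableEq ι] {D : E →L[ℝ] E} {L : ι → E →L[ℝ] E}

namespace IsSymmCliffordSystem

theorem cliffordOp_symm (h : IsSymmCliffordSystem D L) (q v w : E) :
    inner ℝ (cliffordOp L q v) w = inner ℝ v (cliffordOp L q w) := by
  simp only [cliffordOp_apply, sum_inner, inner_sum, inner_smul_left, inner_smul_right, h.symm,
    conj_trivial]

theorem head_cliffordOp (h : IsSymmCliffordSystem D L) (q v : E) :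
    D (cliffordOp L q v) = -cliffordOp L q (D v) := by
  simp only [cliffordOp_apply, map_sum, map_smul, h.anticomm_head, smul_neg,
    Finset.sum_neg_distrib]

theorem apply_cliffordOp (h : IsSymmCliffordSystem D L) (i : ι) (q v : E) :
    L i (cliffordOp L q v) = (2 * cliffordCoeff L q i) • v - cliffordOp L q (L i v) := by
  rw [eq_sub_iff_add_eq, cliffordOp_apply, cliffordOp_apply, map_sum, ← Finset.sum_add_distrib]
  simp only [map_smul, ← smul_add, h.anticomm, smul_ite, smul_zero, Finset.sum_ite_eq,
    Finset.mem_univ, if_true, smul_smul]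
  rw [mul_comm]

theorem cliffordOp_cliffordOp (h : IsSymmCliffordSystem D L) (q v : E) :
    cliffordOp L q (cliffordOp L q v) = cliffordForm L q • v := by
  have h1 : (2 : ℝ) • cliffordOp L q (cliffordOp L q v) = (2 : ℝ) • cliffordForm L q • v := by
    rw [two_smul]
    nth_rewrite 2 [cliffordOp_apply L q v]
    rw [cliffordOp_apply L q (cliffordOp L q v), map_sum, ← Finset.sum_add_distrib]
    simp only [map_smul, ← smul_add, h.apply_cliffordOp, sub_add_cancel, smul_smul,
      ← Finset.sum_smul, cliffordForm, Finset.mul_sum]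
    congr 1
    exact Finset.sum_congr rfl fun i _ => by ring
  exact smul_right_injective E (two_ne_zero (α := ℝ)) h1

theorem inner_self_cliffordGrad (h : IsSymmCliffordSystem D L) (q : E) :
    inner ℝ q (cliffordGrad L q) = 2 * cliffordForm L q := by
  simp only [cliffordGrad, cliffordOp_apply, inner_sum, inner_smul_right, cliffordForm,
    Finset.mul_sum, ← h.symm]
  exact Finset.sum_congr rfl fun i _ => by simp only [cliffordCoeff]; ring

theorem inner_cliffordGrad_cliffordGrad (h : IsSymmCliffordSystem D L) (q : E) :
    inner ℝ (cliffordGrad L q) (cliffordGrad L q) = cliffordForm L q * ‖q‖ ^ 2 := by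
  rw [cliffordGrad, h.cliffordOp_symm, h.cliffordOp_cliffordOp, inner_smul_right,
    real_inner_self_eq_norm_sq]

theorem inner_head_cliffordGrad (h : IsSymmCliffordSystem D L) (q : E) :
    inner ℝ (D q) (cliffordGrad L q) = 0 := by
  simp only [cliffordGrad, cliffordOp_apply, inner_sum, inner_smul_right, h.inner_head_apply,
    mul_zero, Finset.sum_const_zero]

/-- The Gram matrix of `q, D q, G, D G`, where `G` is the gradient at the point `q`. -/
theorem inner_combination (h : IsSymmCliffordSystem D L) {f : ℝ} {q : E}
    (hq : q ∈ cliffordLevelSet D L f) (a b c d a' b' c' d' : ℝ) :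
    inner ℝ (a • q + b • D q + c • cliffordGrad L q + d • D (cliffordGrad L q))
      (a' • q + b' • D q + c' • cliffordGrad L q + d' • D (cliffordGrad L q))
      = a * a' + b * b' + 2 * f * (a * c' + c * a' + b * d' + d * b')
        + f * (c * c' + d * d') := by
  obtain ⟨h1, h2, h3⟩ := hq
  have e1 : inner ℝ q q = (1 : ℝ) := by rw [real_inner_self_eq_norm_sq, h1]
  have e2 : inner ℝ q (cliffordGrad L q) = 2 * f := by rw [h.inner_self_cliffordGrad, h3]
  have e2' : inner ℝ (cliffordGrad L q) q = 2 * f := by rw [real_inner_comm, e2]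
  have e3 : inner ℝ (cliffordGrad L q) (cliffordGrad L q) = f := by
    rw [h.inner_cliffordGrad_cliffordGrad, h3, h1, mul_one]
  have e4 := h.inner_head_cliffordGrad q
  have e4' : inner ℝ (cliffordGrad L q) (D q) = 0 := by rw [real_inner_comm, e4]
  have e5 : inner ℝ q (D q) = 0 := by rw [← h.symm_head, h2]
  have e6 : inner ℝ q (D (cliffordGrad L q)) = 0 := by rw [← h.symm_head, e4]
  have e6' : inner ℝ (D (cliffordGrad L q)) q = 0 := by rw [real_inner_comm, e6]
  have e7 : inner ℝ (D (cliffordGrad L q)) (cliffordGrad L q) = 0 := by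
    unfold cliffordGrad
    rw [h.head_cliffordOp, inner_neg_left, h.cliffordOp_symm, h.cliffordOp_cliffordOp,
      inner_smul_right, h2, mul_zero, neg_zero]
  have e7' : inner ℝ (cliffordGrad L q) (D (cliffordGrad L q)) = 0 := by
    rw [real_inner_comm, e7]
  simp only [inner_add_left, inner_add_right, inner_smul_left, inner_smul_right, conj_trivial,
    h.inner_head_head, e1, e2, e2', e3, e4, e4', e5, e6, e6', e7, e7', h2]
  ring

theorem cliffordHess_head (h : IsSymmCliffordSystem D L) (q : E) :
    cliffordHess L q (D q) = -D (cliffordGrad L q) := by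
  rw [cliffordHess_apply, cliffordGrad, h.head_cliffordOp, neg_neg]
  simp only [real_inner_comm (D q), h.inner_head_apply, zero_smul, Finset.sum_const_zero, zero_add]

theorem cliffordHess_cliffordGrad (h : IsSymmCliffordSystem D L) {q : E} (hq : ‖q‖ ^ 2 = 1) :
    cliffordHess L q (cliffordGrad L q) = cliffordGrad L q + cliffordForm L q • q := by
  have h1 : ∀ i, inner ℝ (L i q) (cliffordGrad L q) = cliffordCoeff L q i := fun i => by
    simp [cliffordGrad, cliffordOp_apply, inner_sum, inner_smul_right, h.inner_apply_apply, hq]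
  rw [cliffordHess_apply]
  simp only [h1]
  rw [← cliffordOp_apply]
  simp only [cliffordGrad, h.cliffordOp_cliffordOp]

theorem cliffordHess_symm (h : IsSymmCliffordSystem D L) (q v w : E) :
    inner ℝ (cliffordHess L q v) w = inner ℝ v (cliffordHess L q w) := by
  simp only [cliffordHess_apply, inner_add_left, inner_add_right, h.cliffordOp_symm, sum_inner,
    inner_sum, inner_smul_left, inner_smul_right, conj_trivial]
  congr 1
  refine Finset.sum_congr rfl fun i _ => ?_
  rw [real_inner_comm v, mul_comm]

theorem sum_inner_apply_cliffordOp (h : IsSymmCliffordSystem D L) (q : E) :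
    ∑ i, inner ℝ (L i q) (cliffordOp L q (L i q))
      = 2 * cliffordForm L q * (2 - Fintype.card ι) := by
  have h1 : ∀ i, inner ℝ (L i q) (cliffordOp L q (L i q))
      = 4 * cliffordCoeff L q i ^ 2 - 2 * cliffordForm L q := fun i => by
    have h2 : cliffordOp L q (L i q) = (2 * cliffordCoeff L q i) • q - L i (cliffordOp L q q) := by
      rw [h.apply_cliffordOp]; abel
    rw [h2, inner_sub_right, inner_smul_right, ← h.symm, h.apply_apply_self,
      ← cliffordGrad, h.inner_self_cliffordGrad]
    simp only [cliffordCoeff]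
    ring
  simp only [h1, Finset.sum_sub_distrib, ← Finset.mul_sum, Finset.sum_const, Finset.card_univ,
    nsmul_eq_mul]
  rw [← cliffordForm]
  ring

variable [FiniteDimensional ℝ E]

theorem trace_sq (h : IsSymmCliffordSystem D L) [Nonempty ι] {f : ℝ} {q : E}
    (hq : q ∈ cliffordLevelSet D L f) (a b : ℝ) {S : E →L[ℝ] E}
    (hS : S = a • D + b • (cliffordHess L q - (2 * f) • ContinuousLinearMap.id ℝ E)) :
    LinearMap.trace ℝ E ((S.comp S : E →L[ℝ] E) : E →ₗ[ℝ] E)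
      = (a ^ 2 + b ^ 2 * (f + 4 * f ^ 2)) * Module.finrank ℝ E
        + 2 * b ^ 2 * (2 * f * (2 - Fintype.card ι) - 2 * f * Fintype.card ι)
        + b ^ 2 * Fintype.card ι := by
  obtain ⟨h1, h2, h3⟩ := hq
  let i₀ : ι := Classical.arbitrary ι
  have trD : LinearMap.trace ℝ E (D : E →ₗ[ℝ] E) = 0 :=
    trace_eq_zero_of_anticomm (S := L i₀) (h.apply_apply_self i₀) (h.anticomm_head i₀)
  have trJ : LinearMap.trace ℝ E (cliffordOp L q : E →ₗ[ℝ] E) = 0 :=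
    trace_eq_zero_of_anticomm h.sq_head fun v => by rw [h.head_cliffordOp, neg_neg]
  let K : E →L[ℝ] E := a • D + b • (cliffordOp L q - (2 * f) • ContinuousLinearMap.id ℝ E)
  have hK : ∀ v, K v = a • D v + b • (cliffordOp L q v - (2 * f) • v) := fun v => by simp [K]
  have hSv : ∀ v, S v = K v + b • ∑ i, inner ℝ (L i q) v • L i q := fun v => by
    rw [hS, hK]
    simp only [add_apply, smul_apply, sub_apply, cliffordHess_apply, ContinuousLinearMap.id_apply]
    module
  have hKsymm : ∀ v w, inner ℝ (K v) w = inner ℝ v (K w) := fun v w => by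
    simp only [hK, inner_add_left, inner_add_right, inner_sub_left, inner_sub_right,
      inner_smul_left, inner_smul_right, h.symm_head, h.cliffordOp_symm, conj_trivial]
  have hSS : ((S.comp S : E →L[ℝ] E) : E →ₗ[ℝ] E)
      = (a ^ 2 + b ^ 2 * (f + 4 * f ^ 2)) • (1 : E →ₗ[ℝ] E)
        - (4 * f * b * a) • (D : E →ₗ[ℝ] E) - (4 * f * b ^ 2) • (cliffordOp L q : E →ₗ[ℝ] E)
        + b • ∑ i, ((innerSL ℝ (L i q)).smulRight (K (L i q)) : E →ₗ[ℝ] E)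
        + b • ∑ i, ((innerSL ℝ (K (L i q))).smulRight (L i q) : E →ₗ[ℝ] E)
        + b ^ 2 • ∑ i, ((innerSL ℝ (L i q)).smulRight (L i q) : E →ₗ[ℝ] E) := by
    ext v
    have hKK : K (K v) = (a ^ 2 + b ^ 2 * (f + 4 * f ^ 2)) • v
        - (4 * f * b * a) • D v - (4 * f * b ^ 2) • cliffordOp L q v := by
      simp only [hK, map_add, map_sub, map_smul, h.sq_head, h.head_cliffordOp,
        h.cliffordOp_cliffordOp, h3]
      module
    have hlin : ∀ j, inner ℝ (L j q) (∑ i, inner ℝ (L i q) v • L i q) = inner ℝ (L j q) v :=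
      fun j => by simp [inner_sum, inner_smul_right, h.inner_apply_apply, h1]
    rw [ContinuousLinearMap.coe_coe, ContinuousLinearMap.comp_apply, hSv (S v)]
    simp only [hSv v, map_add, map_smul, hKK, inner_add_right, inner_smul_right, hlin, add_smul,
      Finset.sum_add_distrib, map_sum, ← hKsymm, mul_smul, ← Finset.smul_sum]
    simp
    module
  have hnorm : ∀ i, inner ℝ (L i q) (L i q) = (1 : ℝ) := fun i => by
    rw [h.inner_apply_apply, if_pos rfl, h1]
  have htr : ∀ v w : E,
      LinearMap.trace ℝ E ((innerSL ℝ v).smulRight w : E →ₗ[ℝ] E) = inner ℝ v w := fun v w => by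
    have : ((innerSL ℝ v).smulRight w : E →ₗ[ℝ] E)
        = ((innerSL ℝ v : E →L[ℝ] ℝ) : E →ₗ[ℝ] ℝ).smulRight w := by
      ext; simp
    rw [this, LinearMap.trace_smulRight]
    simp
  have hsum : ∑ i, inner ℝ (L i q) (K (L i q))
      = b * (2 * f * (2 - Fintype.card ι) - 2 * f * Fintype.card ι) := by
    have h4 : ∀ i, inner ℝ (L i q) (K (L i q))
        = b * inner ℝ (L i q) (cliffordOp L q (L i q)) - b * (2 * f) := fun i => by
      have h5 : inner ℝ (L i q) (D (L i q)) = 0 := by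
        rw [h.anticomm_head, inner_neg_right, ← h.symm, h.apply_apply_self, ← h.symm_head, h2,
          neg_zero]
      rw [hK, inner_add_right, inner_smul_right, h5, inner_smul_right, inner_sub_right,
        inner_smul_right, hnorm]
      ring
    simp only [h4, Finset.sum_sub_distrib, ← Finset.mul_sum, h.sum_inner_apply_cliffordOp, h3,
      Finset.sum_const, Finset.card_univ, nsmul_eq_mul]
    ring
  have hsum' : ∑ i, inner ℝ (K (L i q)) (L i q)
      = b * (2 * f * (2 - Fintype.card ι) - 2 * f * Fintype.card ι) := by
    rw [← hsum]
    exact Finset.sum_congr rfl fun i _ => hKsymm _ _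
  rw [hSS]
  simp only [map_add, map_sub, map_smul, map_sum, htr, hsum, hsum', hnorm, trD, trJ,
    LinearMap.trace_one, smul_eq_mul, Finset.sum_const, Finset.card_univ, nsmul_eq_mul]
  ring

end IsSymmCliffordSystem

end CliffordSystem

section LevelSet

variable {E : Type*} [NormedAddCommGroup E] [InnerProductSpace ℝ E] {ι : Type*}

theorem hasFDerivAt_inner_apply_self {T : E →L[ℝ] E}
    (hT : ∀ v w, inner ℝ (T v) w = inner ℝ v (T w)) (q : E) :
    HasFDerivAt (fun v => inner ℝ (T v) v) ((2 : ℝ) • innerSL ℝ (T q)) q := by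
  have h1 := (T.hasFDerivAt (x := q)).inner ℝ (hasFDerivAt_id q)
  refine h1.congr_fderiv ?_
  ext v
  simp only [fderivInnerCLM_apply, ContinuousLinearMap.comp_apply, ContinuousLinearMap.prod_apply,
    ContinuousLinearMap.id_apply, smul_apply, innerSL_apply_apply, smul_eq_mul, id_eq]
  rw [hT v q, real_inner_comm v (T q)]
  ring

theorem mem_tangentSpaceAt_unitSphere [FiniteDimensional ℝ E] {p v : E} (hp : ‖p‖ ^ 2 = 1) :
    v ∈ tangentSpaceAt (Metric.sphere (0 : E) 1) p ↔ inner ℝ p v = 0 := by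
  have hsm : ContDiffAt ℝ ∞ (fun q : E => ‖q‖ ^ 2 - 1) p :=
    ((contDiff_norm_sq ℝ).sub contDiff_const).contDiffAt
  have hd : HasFDerivAt (fun q : E => ‖q‖ ^ 2 - 1) ((2 : ℝ) • innerSL ℝ p) p := by
    have h1 := (hasFDerivAt_inner_apply_self (T := ContinuousLinearMap.id ℝ E)
      (fun _ _ => rfl) p).sub_const 1
    simpa [real_inner_self_eq_norm_sq] using h1
  have hpp : inner ℝ p p = (1 : ℝ) := by rw [real_inner_self_eq_norm_sq, hp]
  rw [mem_tangentSpaceAt_iff hsm, hd.fderiv]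
  · simp
  · rw [hd.fderiv]
    intro t
    exact ⟨(t / 2) • p, by simp [hp]⟩
  · intro q
    rw [mem_sphere_zero_iff_norm, sub_eq_zero, pow_eq_one_iff_of_nonneg (norm_nonneg q) two_ne_zero]
  · rw [mem_sphere_zero_iff_norm]
    exact (pow_eq_one_iff_of_nonneg (norm_nonneg p) two_ne_zero).1 hp

theorem IsSymmCliffordSystem.hasFDerivAt_cliffordCoeff [DecidableEq ι] {D : E →L[ℝ] E}
    {L : ι → E →L[ℝ] E} (h : IsSymmCliffordSystem D L) (q : E) (i : ι) :
    HasFDerivAt (fun v => cliffordCoeff L v i) (innerSL ℝ (L i q)) q := by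
  have h1 := (hasFDerivAt_inner_apply_self (h.symm i) q).mul_const (1 / 2)
  refine (h1.congr_fderiv ?_).congr_of_eventuallyEq (Filter.Eventually.of_forall fun v => ?_)
  · rw [smul_smul]; norm_num
  · simp only [cliffordCoeff]; ring

variable [Fintype ι]

/-- The defining equations of `cliffordLevelSet D L f`. -/
noncomputable def constraintMap (D : E →L[ℝ] E) (L : ι → E →L[ℝ] E) (f : ℝ) (q : E) :
    EuclideanSpace ℝ (Fin 3) :=
  !₂[‖q‖ ^ 2 - 1, inner ℝ (D q) q, cliffordForm L q - f]

/-- The differential of `constraintMap`. -/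
noncomputable def constraintDeriv (D : E →L[ℝ] E) (L : ι → E →L[ℝ] E) (q : E) :
    E →L[ℝ] EuclideanSpace ℝ (Fin 3) :=
  ((EuclideanSpace.equiv (Fin 3) ℝ).symm : (Fin 3 → ℝ) →L[ℝ] EuclideanSpace ℝ (Fin 3)).comp
    (ContinuousLinearMap.pi fun i => (2 : ℝ) • innerSL ℝ (![q, D q, cliffordGrad L q] i))

theorem mem_cliffordLevelSet_iff {D : E →L[ℝ] E} {L : ι → E →L[ℝ] E} {f : ℝ} {q : E} :
    q ∈ cliffordLevelSet D L f ↔ constraintMap D L f q = 0 := by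
  rw [PiLp.ext_iff]
  simp [cliffordLevelSet, constraintMap, Fin.forall_fin_succ, sub_eq_zero]

theorem constraintDeriv_apply (D : E →L[ℝ] E) (L : ι → E →L[ℝ] E) (q v : E) (i : Fin 3) :
    constraintDeriv D L q v i = 2 * inner ℝ (![q, D q, cliffordGrad L q] i) v := by
  simp [constraintDeriv]

theorem contDiff_constraintMap (D : E →L[ℝ] E) (L : ι → E →L[ℝ] E) (f : ℝ) :
    ContDiff ℝ ∞ (constraintMap D L f) := by
  rw [contDiff_euclidean]
  intro i
  fin_cases i
  · exact (contDiff_norm_sq ℝ).sub contDiff_const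
  · exact D.contDiff.inner ℝ contDiff_id
  · refine ContDiff.sub ?_ contDiff_const
    refine ContDiff.sum fun i _ => ContDiff.pow (ContDiff.div_const ?_ _) 2
    exact (L i).contDiff.inner ℝ contDiff_id

/-- The orthonormal normal frame field `q`, `D q`, `(G(q) - 2 f q) / s` along the level set, where
`G` is the gradient of the form. -/
noncomputable def normalFrame (D : E →L[ℝ] E) (L : ι → E →L[ℝ] E) (f s : ℝ) (i : Fin 3) (q : E) :
    E :=
  ![q, D q, s⁻¹ • (cliffordGrad L q - (2 * f) • q)] i

/-- The differential of `normalFrame`. -/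
noncomputable def normalFrameDeriv (D : E →L[ℝ] E) (L : ι → E →L[ℝ] E) (f s : ℝ) (q : E)
    (i : Fin 3) : E →L[ℝ] E :=
  ![ContinuousLinearMap.id ℝ E, D,
    s⁻¹ • (cliffordHess L q - (2 * f) • ContinuousLinearMap.id ℝ E)] i

variable [DecidableEq ι] {D : E →L[ℝ] E} {L : ι → E →L[ℝ] E}

namespace IsSymmCliffordSystem

theorem hasFDerivAt_cliffordForm (h : IsSymmCliffordSystem D L) (q : E) :
    HasFDerivAt (cliffordForm L) ((2 : ℝ) • innerSL ℝ (cliffordGrad L q)) q := by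
  have h1 : ∀ i ∈ (Finset.univ : Finset ι), HasFDerivAt (fun v => cliffordCoeff L v i ^ 2)
      ((2 * cliffordCoeff L q i) • innerSL ℝ (L i q)) q := fun i _ => by
    have := (h.hasFDerivAt_cliffordCoeff q i).pow 2
    simpa using this
  refine (HasFDerivAt.fun_sum h1).congr_fderiv ?_
  ext v
  simp [cliffordGrad, cliffordOp_apply, Finset.mul_sum, mul_assoc]

theorem hasFDerivAt_cliffordGrad (h : IsSymmCliffordSystem D L) (q : E) :
    HasFDerivAt (cliffordGrad L) (cliffordHess L q) q := by
  have h1 : ∀ i ∈ (Finset.univ : Finset ι), HasFDerivAt (fun v => cliffordCoeff L v i • L i v)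
      (cliffordCoeff L q i • L i + (innerSL ℝ (L i q)).smulRight (L i q)) q := fun i _ =>
    (h.hasFDerivAt_cliffordCoeff q i).smul (L i).hasFDerivAt
  refine ((HasFDerivAt.fun_sum h1).congr_fderiv ?_).congr_of_eventuallyEq
    (Filter.Eventually.of_forall fun v => ?_)
  · rw [Finset.sum_add_distrib, cliffordHess, cliffordOp, add_comm]
  · rw [cliffordGrad, cliffordOp_apply]

theorem hasFDerivAt_constraintMap (h : IsSymmCliffordSystem D L) (f : ℝ) (q : E) :
    HasFDerivAt (constraintMap D L f) (constraintDeriv D L q) q := by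
  rw [← hasFDerivWithinAt_univ, hasFDerivWithinAt_euclidean]
  intro i
  have key : (PiLp.proj 2 (fun _ : Fin 3 => ℝ) i : EuclideanSpace ℝ (Fin 3) →L[ℝ] ℝ).comp
      (constraintDeriv D L q) = (2 : ℝ) • innerSL ℝ (![q, D q, cliffordGrad L q] i) := by
    ext v
    simpa using constraintDeriv_apply D L q v i
  rw [hasFDerivWithinAt_univ]
  refine HasFDerivAt.congr_fderiv ?_ key.symm
  fin_cases i
  · have h1 := (hasFDerivAt_inner_apply_self (T := ContinuousLinearMap.id ℝ E)
      (fun _ _ => rfl) q).sub_const 1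
    simpa [constraintMap, real_inner_self_eq_norm_sq] using h1
  · simpa [constraintMap] using hasFDerivAt_inner_apply_self h.symm_head q
  · simpa [constraintMap] using (h.hasFDerivAt_cliffordForm q).sub_const f

theorem hasFDerivAt_normalFrame (h : IsSymmCliffordSystem D L) (f s : ℝ) (q : E) (i : Fin 3) :
    HasFDerivAt (normalFrame D L f s i) (normalFrameDeriv D L f s q i) q := by
  fin_cases i
  · exact hasFDerivAt_id q
  · exact D.hasFDerivAt
  · exact ((h.hasFDerivAt_cliffordGrad q).sub ((hasFDerivAt_id q).const_smul (2 * f))).const_smul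
      s⁻¹

theorem orthonormal_normalFrame (h : IsSymmCliffordSystem D L) {f s : ℝ} (hs : s ≠ 0)
    (hsf : s ^ 2 = f * (1 - 4 * f)) {q : E} (hq : q ∈ cliffordLevelSet D L f) :
    Orthonormal ℝ fun i => normalFrame D L f s i q := by
  have e0 : normalFrame D L f s 0 q
      = (1 : ℝ) • q + (0 : ℝ) • D q + (0 : ℝ) • cliffordGrad L q
        + (0 : ℝ) • D (cliffordGrad L q) := by simp [normalFrame]
  have e1 : normalFrame D L f s 1 q
      = (0 : ℝ) • q + (1 : ℝ) • D q + (0 : ℝ) • cliffordGrad L q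
        + (0 : ℝ) • D (cliffordGrad L q) := by simp [normalFrame]
  have e2 : normalFrame D L f s 2 q
      = (-(2 * f) * s⁻¹) • q + (0 : ℝ) • D q + s⁻¹ • cliffordGrad L q
        + (0 : ℝ) • D (cliffordGrad L q) := by simp [normalFrame]; module
  rw [orthonormal_iff_ite]
  have h22 : -(2 * f) * s⁻¹ * (-(2 * f) * s⁻¹) + 2 * f * (-(2 * f) * s⁻¹ * s⁻¹
      + s⁻¹ * (-(2 * f) * s⁻¹)) + f * (s⁻¹ * s⁻¹) = 1 := by
    field_simp
    linarith
  intro i j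
  fin_cases i <;> fin_cases j <;>
    simp only [Fin.zero_eta, Fin.mk_one, Fin.reduceFinMk, e0, e1, e2, h.inner_combination hq] <;>
    simp only [Fin.reduceEq, Fin.isValue, if_true, if_false]
  all_goals first | linear_combination h22 | ring

theorem surjective_constraintDeriv (h : IsSymmCliffordSystem D L) {f s : ℝ} (hs : s ≠ 0)
    (hsf : s ^ 2 = f * (1 - 4 * f)) {q : E} (hq : q ∈ cliffordLevelSet D L f) :
    Function.Surjective (constraintDeriv D L q) := by
  intro t
  have e : ∀ a b c : ℝ, inner ℝ (a • q + b • D q + c • cliffordGrad L q)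
      (((t 0 - 2 * f * (t 2 - 2 * f * t 0) / s ^ 2) / 2) • q + (t 1 / 2) • D q
        + ((t 2 - 2 * f * t 0) / (2 * s ^ 2)) • cliffordGrad L q)
      = (a * t 0 + b * t 1 + c * t 2) / 2 := by
    intro a b c
    have := h.inner_combination hq a b c 0 ((t 0 - 2 * f * (t 2 - 2 * f * t 0) / s ^ 2) / 2)
      (t 1 / 2) ((t 2 - 2 * f * t 0) / (2 * s ^ 2)) 0
    simp only [zero_smul, add_zero] at this
    rw [this]
    field_simp
    linear_combination (-(c * (t 2 - 2 * f * t 0))) * hsf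
  refine ⟨((t 0 - 2 * f * (t 2 - 2 * f * t 0) / s ^ 2) / 2) • q + (t 1 / 2) • D q
    + ((t 2 - 2 * f * t 0) / (2 * s ^ 2)) • cliffordGrad L q, PiLp.ext fun i => ?_⟩
  rw [constraintDeriv_apply]
  fin_cases i
  · have := e 1 0 0
    simp only [one_smul, zero_smul, add_zero] at this
    simp [this, mul_div_cancel₀]
  · have := e 0 1 0
    simp only [one_smul, zero_smul, add_zero, zero_add] at this
    simp [this, mul_div_cancel₀]
  · have := e 0 0 1
    simp only [one_smul, zero_smul, add_zero, zero_add] at this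
    simp [this, mul_div_cancel₀]

variable [FiniteDimensional ℝ E]

theorem isSubmanifoldOfCodim (h : IsSymmCliffordSystem D L) {f s : ℝ} (hs : s ≠ 0)
    (hsf : s ^ 2 = f * (1 - 4 * f)) : IsSubmanifoldOfCodim 3 (cliffordLevelSet D L f) := by
  intro p hp
  have hfd : ∀ q, fderiv ℝ (constraintMap D L f) q = constraintDeriv D L q := fun q =>
    (h.hasFDerivAt_constraintMap f q).fderiv
  refine ⟨{q | Function.Surjective (fderiv ℝ (constraintMap D L f) q)}, constraintMap D L f,
    ?_, ?_, (contDiff_constraintMap D L f).contDiffOn, fun q hq => hq, ?_⟩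
  · exact isOpen_setOf_surjective.preimage
      ((contDiff_constraintMap D L f).continuous_fderiv (by simp))
  · rw [Set.mem_ofPred_eq, hfd]
    exact h.surjective_constraintDeriv hs hsf hp
  · ext q
    rw [Set.mem_inter_iff, mem_cliffordLevelSet_iff, and_comm]
    rfl

theorem tangentSpaceAt_cliffordLevelSet (h : IsSymmCliffordSystem D L) {f s : ℝ} (hs : s ≠ 0)
    (hsf : s ^ 2 = f * (1 - 4 * f)) {q : E} (hq : q ∈ cliffordLevelSet D L f) :
    tangentSpaceAt (cliffordLevelSet D L f) q
      = (Submodule.span ℝ (Set.range fun i => normalFrame D L f s i q))ᗮ := by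
  ext v
  have hfd := (h.hasFDerivAt_constraintMap f q).fderiv
  rw [mem_tangentSpaceAt_iff (contDiff_constraintMap D L f).contDiffAt
    (by rw [hfd]; exact h.surjective_constraintDeriv hs hsf hq)
    (fun _ => mem_cliffordLevelSet_iff) hq, hfd, PiLp.ext_iff]
  have horth : v ∈ (Submodule.span ℝ (Set.range fun i => normalFrame D L f s i q))ᗮ
      ↔ ∀ i, inner ℝ (normalFrame D L f s i q) v = 0 := by
    rw [Submodule.mem_orthogonal]
    constructor
    · exact fun H i => H _ (Submodule.subset_span ⟨i, rfl⟩)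
    · intro H u hu
      induction hu using Submodule.span_induction with
      | mem x hx => obtain ⟨j, rfl⟩ := hx; exact H j
      | zero => simp
      | add x y _ _ hx hy => rw [inner_add_left, hx, hy, add_zero]
      | smul a x _ hx => rw [inner_smul_left, hx, mul_zero]
  rw [horth]
  simp only [constraintDeriv_apply, Fin.forall_fin_succ, normalFrame]
  simp only [Matrix.cons_val_zero, Matrix.cons_val_succ, inner_smul_left,
    inner_sub_left, conj_trivial, PiLp.zero_apply]
  constructor
  · rintro ⟨h0, h1, h2, -⟩
    have h0' : inner ℝ q v = 0 := by linarith
    refine ⟨h0', by simpa using h1, ?_, by simp⟩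
    have : inner ℝ (cliffordGrad L q) v = 0 := by simpa using h2
    simp [this, h0']
  · rintro ⟨h0, h1, h2, -⟩
    refine ⟨by rw [h0, mul_zero], by simpa using h1, ?_, by simp⟩
    simpa [h0, hs] using h2

/-- The value of `‖B^ν‖²` for `ν = a D p + b n₃`. -/
theorem sffNormSq_eq (h : IsSymmCliffordSystem D L) [Nonempty ι] {f s : ℝ} (hs : s ≠ 0)
    (hsf : s ^ 2 = f * (1 - 4 * f))
    (hf : 2 * f * (Module.finrank ℝ E - 4) = (Fintype.card ι : ℝ) - 1)
    {p ν : E} (hp : p ∈ cliffordLevelSet D L f)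
    (hν : ν ∈ normalSpaceAt (Metric.sphere (0 : E) 1) (cliffordLevelSet D L f) p) :
    sffNormSq (Metric.sphere (0 : E) 1) (cliffordLevelSet D L f) p ν
      = (Module.finrank ℝ E - 4) * (inner ℝ (normalFrame D L f s 1 p) ν ^ 2
        + 3 * inner ℝ (normalFrame D L f s 2 p) ν ^ 2) := by
  set a := inner ℝ (normalFrame D L f s 1 p) ν with ha
  set b := inner ℝ (normalFrame D L f s 2 p) ν with hb
  have h0 : inner ℝ (normalFrame D L f s 0 p) ν = 0 :=
    (mem_tangentSpaceAt_unitSphere hp.1).1 hν.2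
  let S : E →L[ℝ] E :=
    a • D + (b * s⁻¹) • (cliffordHess L p - (2 * f) • ContinuousLinearMap.id ℝ E)
  have hSv : ∀ v, S v = a • D v + (b * s⁻¹) • (cliffordHess L p v - (2 * f) • v) := fun v => by
    simp [S]
  have hSsymm : ∀ v w, inner ℝ (S v) w = inner ℝ v (S w) := fun v w => by
    simp only [hSv, inner_add_left, inner_add_right, inner_sub_left, inner_sub_right,
      inner_smul_left, inner_smul_right, h.symm_head, h.cliffordHess_symm, conj_trivial]
  have hT := h.tangentSpaceAt_cliffordLevelSet hs hsf hp
  have ho := h.orthonormal_normalFrame hs hsf hp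
  have hB : ∀ X ∈ tangentSpaceAt (cliffordLevelSet D L f) p,
      ∀ Y ∈ tangentSpaceAt (cliffordLevelSet D L f) p,
      (inner ℝ (secondFundamentalForm (Metric.sphere (0 : E) 1) (cliffordLevelSet D L f) p X Y)
        ν) ^ 2 = (inner ℝ (S X) Y) ^ 2 := by
    intro X hX Y hY
    rw [inner_secondFundamentalForm hp (fun i => h.hasFDerivAt_normalFrame f s p i)
      (fun q hq => h.orthonormal_normalFrame hs hsf hq)
      (fun q hq => h.tangentSpaceAt_cliffordLevelSet hs hsf hq) hX hY hν, neg_sq,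
      Fin.sum_univ_three, h0, ← ha, ← hb, hSv]
    simp [normalFrameDeriv, inner_add_left, inner_smul_left]
    ring
  have hsum : sffNormSq (Metric.sphere (0 : E) 1) (cliffordLevelSet D L f) p ν
      = ∑ i, ∑ j, (inner ℝ (S (stdOrthonormalBasis ℝ
          (tangentSpaceAt (cliffordLevelSet D L f) p) i))
          (stdOrthonormalBasis ℝ (tangentSpaceAt (cliffordLevelSet D L f) p) j : E)) ^ 2 :=
    Finset.sum_congr rfl fun i _ => Finset.sum_congr rfl fun j _ =>
      hB _ (Subtype.prop _) _ (Subtype.prop _)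
  rw [hsum, sum_inner_sq_compression ho hT _ hSsymm, h.trace_sq hp a (b * s⁻¹) rfl]
  set c := b * s⁻¹ with hc
  have hbc : b = s * c := by rw [hc]; field_simp
  have n0 : normalFrame D L f s 0 p
      = (1 : ℝ) • p + (0 : ℝ) • D p + (0 : ℝ) • cliffordGrad L p
        + (0 : ℝ) • D (cliffordGrad L p) := by simp [normalFrame]
  have n1 : normalFrame D L f s 1 p
      = (0 : ℝ) • p + (1 : ℝ) • D p + (0 : ℝ) • cliffordGrad L p
        + (0 : ℝ) • D (cliffordGrad L p) := by simp [normalFrame]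
  have n2 : normalFrame D L f s 2 p
      = (-(2 * f) * s⁻¹) • p + (0 : ℝ) • D p + s⁻¹ • cliffordGrad L p
        + (0 : ℝ) • D (cliffordGrad L p) := by simp [normalFrame]; module
  have S0 : S (normalFrame D L f s 0 p)
      = (-(2 * f) * c) • p + a • D p + (3 * c) • cliffordGrad L p
        + (0 : ℝ) • D (cliffordGrad L p) := by
    simp only [normalFrame, Matrix.cons_val_zero, hSv, cliffordHess_self]
    module
  have S1 : S (normalFrame D L f s 1 p)
      = a • p + (-(2 * f) * c) • D p + (0 : ℝ) • cliffordGrad L p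
        + (-c) • D (cliffordGrad L p) := by
    simp only [normalFrame, Matrix.cons_val_one, Matrix.cons_val_zero, hSv, h.cliffordHess_head,
      h.sq_head]
    module
  have S2 : S (normalFrame D L f s 2 p)
      = (s⁻¹ * c * (f + 4 * f ^ 2)) • p + (-(2 * f) * s⁻¹ * a) • D p
        + (s⁻¹ * c * (1 - 8 * f)) • cliffordGrad L p + (s⁻¹ * a) • D (cliffordGrad L p) := by
    have : normalFrame D L f s 2 p = s⁻¹ • (cliffordGrad L p - (2 * f) • p) := rfl
    rw [this, hSv]
    simp only [map_smul, map_sub, cliffordHess_self, h.cliffordHess_cliffordGrad hp.1, hp.2.2]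
    module
  have hr : s⁻¹ * s⁻¹ * (f * (1 - 4 * f)) = 1 := by rw [← hsf]; field_simp
  have hr' : s⁻¹ * (f * (1 - 4 * f)) = s := by rw [← hsf]; field_simp
  have hm : (Fintype.card ι : ℝ) = 2 * f * (Module.finrank ℝ E - 4) + 1 := by linarith
  have I00 : inner ℝ (S (normalFrame D L f s 0 p)) (normalFrame D L f s 0 p) = 4 * f * c := by
    rw [S0, n0, h.inner_combination hp]; ring
  have I01 : inner ℝ (S (normalFrame D L f s 0 p)) (normalFrame D L f s 1 p) = a := by
    rw [S0, n1, h.inner_combination hp]; ring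
  have I02 : inner ℝ (S (normalFrame D L f s 0 p)) (normalFrame D L f s 2 p) = 3 * c * s := by
    rw [S0, n2, h.inner_combination hp]; linear_combination 3 * c * hr'
  have I11 : inner ℝ (S (normalFrame D L f s 1 p)) (normalFrame D L f s 1 p) = -(4 * f * c) := by
    rw [S1, n1, h.inner_combination hp]; ring
  have I12 : inner ℝ (S (normalFrame D L f s 1 p)) (normalFrame D L f s 2 p) = 0 := by
    rw [S1, n2, h.inner_combination hp]; ring
  have I22 : inner ℝ (S (normalFrame D L f s 2 p)) (normalFrame D L f s 2 p)
      = c * (1 - 8 * f) := by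
    rw [S2, n2, h.inner_combination hp]; linear_combination c * (1 - 8 * f) * hr
  have I10 : inner ℝ (S (normalFrame D L f s 1 p)) (normalFrame D L f s 0 p) = a := by
    rw [hSsymm, real_inner_comm, I01]
  have I20 : inner ℝ (S (normalFrame D L f s 2 p)) (normalFrame D L f s 0 p) = 3 * c * s := by
    rw [hSsymm, real_inner_comm, I02]
  have I21 : inner ℝ (S (normalFrame D L f s 2 p)) (normalFrame D L f s 1 p) = 0 := by
    rw [hSsymm, real_inner_comm, I12]
  have N0 : ‖S (normalFrame D L f s 0 p)‖ ^ 2 = a ^ 2 + c ^ 2 * (9 * f - 20 * f ^ 2) := by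
    rw [← real_inner_self_eq_norm_sq, S0, h.inner_combination hp]; ring
  have N1 : ‖S (normalFrame D L f s 1 p)‖ ^ 2 = a ^ 2 + c ^ 2 * (f + 12 * f ^ 2) := by
    rw [← real_inner_self_eq_norm_sq, S1, h.inner_combination hp]; ring
  have N2 : ‖S (normalFrame D L f s 2 p)‖ ^ 2
      = a ^ 2 + c ^ 2 * (1 - 7 * f + 28 * f ^ 2) := by
    rw [← real_inner_self_eq_norm_sq, S2, h.inner_combination hp]
    linear_combination (a ^ 2 + c ^ 2 * (1 - 7 * f + 28 * f ^ 2)) * hr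
  simp only [Fin.sum_univ_three, I00, I01, I02, I10, I11, I12, I20, I21, I22, N0, N1, N2]
  rw [hbc, hm]
  linear_combination (18 - 3 * ((Module.finrank ℝ E : ℝ) - 4)) * c ^ 2 * hsf

end IsSymmCliffordSystem
end LevelSet
section Supremum

variable {E : Type*} [NormedAddCommGroup E] [InnerProductSpace ℝ E] [FiniteDimensional ℝ E]
  {ι : Type*} [Fintype ι] [DecidableEq ι] {D : E →L[ℝ] E} {L : ι → E →L[ℝ] E}

theorem IsSymmCliffordSystem.isLUB_sffNormSqValues (h : IsSymmCliffordSystem D L) [Nonempty ι]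
    {f s : ℝ} (hs : s ≠ 0) (hsf : s ^ 2 = f * (1 - 4 * f))
    (hf : 2 * f * (Module.finrank ℝ E - 4) = (Fintype.card ι : ℝ) - 1)
    (hE : 4 ≤ Module.finrank ℝ E) (hM : (cliffordLevelSet D L f).Nonempty) :
    IsLUB (sffNormSqValues (Metric.sphere (0 : E) 1) (cliffordLevelSet D L f))
      (3 * (Module.finrank ℝ E - 4)) := by
  have hE' : (0 : ℝ) ≤ Module.finrank ℝ E - 4 := by
    have : (4 : ℝ) ≤ Module.finrank ℝ E := by exact_mod_cast hE
    linarith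
  constructor
  · rintro r ⟨p, hp, ν, hν, hν1, rfl⟩
    rw [h.sffNormSq_eq hs hsf hf hp hν, mul_comm]
    refine mul_le_mul_of_nonneg_right ?_ hE'
    have hb := (h.orthonormal_normalFrame hs hsf hp).sum_inner_products_le ν (s := Finset.univ)
    simp only [Fin.sum_univ_three, Real.norm_eq_abs, sq_abs, hν1] at hb
    nlinarith [sq_nonneg (inner ℝ (normalFrame D L f s 0 p) ν),
      sq_nonneg (inner ℝ (normalFrame D L f s 1 p) ν)]
  · intro B hB
    obtain ⟨p, hp⟩ := hM
    have ho := h.orthonormal_normalFrame hs hsf hp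
    have hν : normalFrame D L f s 2 p
        ∈ normalSpaceAt (Metric.sphere (0 : E) 1) (cliffordLevelSet D L f) p := by
      refine ⟨?_, (mem_tangentSpaceAt_unitSphere hp.1).2 ?_⟩
      · rw [h.tangentSpaceAt_cliffordLevelSet hs hsf hp]
        exact Submodule.le_orthogonal_orthogonal _ (Submodule.subset_span ⟨2, rfl⟩)
      · exact ho.2 (show (0 : Fin 3) ≠ 2 by decide)
    refine hB ⟨p, hp, _, hν, ho.1 2, ?_⟩
    have h12 : inner ℝ (normalFrame D L f s 1 p) (normalFrame D L f s 2 p) = 0 :=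
      ho.2 (show (1 : Fin 3) ≠ 2 by decide)
    have h22 : ‖normalFrame D L f s 2 p‖ = 1 := ho.1 2
    rw [h.sffNormSq_eq hs hsf hf hp hν, h12, real_inner_self_eq_norm_sq, h22]
    ring

end Supremum

section Doubling

variable {n r : ℕ}

/-- The operator `(x, y) ↦ (P y, Q x)`. -/
noncomputable def swapOp (P Q : V n →L[ℝ] V n) : W n →L[ℝ] W n :=
  ((WithLp.prodContinuousLinearEquiv 2 ℝ (V n) (V n)).symm : (V n × V n) →L[ℝ] W n).comp
    (((P.comp (ContinuousLinearMap.snd ℝ (V n) (V n))).prod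
      (Q.comp (ContinuousLinearMap.fst ℝ (V n) (V n)))).comp
      (WithLp.prodContinuousLinearEquiv 2 ℝ (V n) (V n) : W n →L[ℝ] (V n × V n)))

/-- The reflection `(x, y) ↦ (x, -y)`. -/
noncomputable def reflOp (n : ℕ) : W n →L[ℝ] W n :=
  ((WithLp.prodContinuousLinearEquiv 2 ℝ (V n) (V n)).symm : (V n × V n) →L[ℝ] W n).comp
    (((ContinuousLinearMap.fst ℝ (V n) (V n)).prod
      (-(ContinuousLinearMap.snd ℝ (V n) (V n)))).comp
      (WithLp.prodContinuousLinearEquiv 2 ℝ (V n) (V n) : W n →L[ℝ] (V n × V n)))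

@[simp] theorem swapOp_fst (P Q : V n →L[ℝ] V n) (z : W n) : (swapOp P Q z).fst = P z.snd := rfl
@[simp] theorem swapOp_snd (P Q : V n →L[ℝ] V n) (z : W n) : (swapOp P Q z).snd = Q z.fst := rfl
@[simp] theorem reflOp_fst (z : W n) : (reflOp n z).fst = z.fst := rfl
@[simp] theorem reflOp_snd (z : W n) : (reflOp n z).snd = -z.snd := rfl

/-- The family `I, A_1, …, A_r`. -/
def withId (A : Fin r → V n →L[ℝ] V n) (i : Option (Fin r)) : V n →L[ℝ] V n :=
  i.elim (ContinuousLinearMap.id ℝ (V n)) A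

/-- The symmetric Clifford system `(x, y) ↦ (C_iᵀ y, C_i x)` on `ℝ^{2n+2}`, where `C` is the family
`I, A_1, …, A_r`. -/
noncomputable def doubledSystem (A : Fin r → V n →L[ℝ] V n) (i : Option (Fin r)) :
    W n →L[ℝ] W n :=
  swapOp (ContinuousLinearMap.adjoint (withId A i)) (withId A i)

theorem wext {z w : W n} (h₁ : z.fst = w.fst) (h₂ : z.snd = w.snd) : z = w :=
  (WithLp.equiv 2 _).injective (Prod.ext h₁ h₂)

variable {A : Fin r → V n →L[ℝ] V n}

theorem IsSkewCliffordSystem.apply_apply (hA : IsSkewCliffordSystem A) (p q : Fin r) (v : V n) :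
    A p (A q v) + A q (A p v) = if p = q then (-2 : ℝ) • v else 0 := by
  have := DFunLike.congr_fun (hA.anticomm p q) v
  split_ifs at this ⊢ <;> simpa using this

theorem IsSkewCliffordSystem.adjoint_apply (hA : IsSkewCliffordSystem A) (q : Fin r) (v : V n) :
    ContinuousLinearMap.adjoint (A q) v = -A q v := by
  rw [hA.skew]; rfl

theorem IsSkewCliffordSystem.isSymmCliffordSystem (hA : IsSkewCliffordSystem A) :
    IsSymmCliffordSystem (reflOp n) (doubledSystem A) where
  symm_head v w := by simp [WithLp.prod_inner_apply]
  symm i v w := by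
    simp [doubledSystem, WithLp.prod_inner_apply, ContinuousLinearMap.adjoint_inner_left,
      ContinuousLinearMap.adjoint_inner_right, add_comm]
  sq_head v := wext (by simp) (by simp)
  anticomm_head i v := wext (by simp [doubledSystem]) (by simp [doubledSystem])
  anticomm i j v := by
    have key : ∀ p q : Fin r, ∀ x : V n,
        -A p (A q x) + -A q (A p x) = if p = q then (2 : ℝ) • x else 0 := fun p q x => by
      rw [← neg_add, hA.apply_apply]
      split_ifs <;> simp
    have hid : ContinuousLinearMap.adjoint (ContinuousLinearMap.id ℝ (V n))
      = ContinuousLinearMap.id ℝ (V n) := ContinuousLinearMap.adjoint_id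
    rcases i with _ | p <;> rcases j with _ | q
    · apply wext <;> simp [doubledSystem, withId, hid, two_smul]
    · apply wext <;> simp [doubledSystem, withId, hid, hA.adjoint_apply]
    · apply wext <;> simp [doubledSystem, withId, hid, hA.adjoint_apply]
    · apply wext
      · have := key p q v.fst
        simp only [doubledSystem, withId, Option.elim, WithLp.add_fst, swapOp_fst, swapOp_snd,
          hA.adjoint_apply, this, Option.some.injEq]
        split_ifs <;> simp
      · have := key p q v.snd
        simp only [doubledSystem, withId, Option.elim, WithLp.add_snd, swapOp_fst, swapOp_snd,
          hA.adjoint_apply, map_neg, this, Option.some.injEq]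
        split_ifs <;> simp

theorem cliffordForm_doubledSystem (A : Fin r → V n →L[ℝ] V n) (z : W n) :
    cliffordForm (doubledSystem A) z = splittingForm A z := by
  have h1 : ∀ i, cliffordCoeff (doubledSystem A) z i = inner ℝ (withId A i z.fst) z.snd := by
    intro i
    rw [cliffordCoeff, doubledSystem, WithLp.prod_inner_apply]
    simp only [WithLp.ofLp_fst, WithLp.ofLp_snd, swapOp_fst, swapOp_snd,
      ContinuousLinearMap.adjoint_inner_left, real_inner_comm]
    rw [real_inner_comm]
    ring
  simp only [cliffordForm, h1, Fintype.sum_option, splittingForm, withId, Option.elim,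
    ContinuousLinearMap.id_apply]

theorem splittingForm_smul (A : Fin r → V n →L[ℝ] V n) (t : ℝ) (z : W n) :
    splittingForm A (t • z) = t ^ 4 * splittingForm A z := by
  simp only [splittingForm, WithLp.smul_fst, WithLp.smul_snd, map_smul, inner_smul_left,
    inner_smul_right, conj_trivial, mul_add, Finset.mul_sum]
  congr 1
  · ring
  · exact Finset.sum_congr rfl fun i _ => by ring

theorem smul_levelSet_eq (A : Fin r → V n →L[ℝ] V n) (c : ℝ) :
    (1 / Real.sqrt 2) • levelSet A c
      = cliffordLevelSet (reflOp n) (doubledSystem A) (c / 4) := by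
  have h2 : Real.sqrt 2 ^ 2 = 2 := Real.sq_sqrt (by norm_num)
  have h2p : 0 < Real.sqrt 2 := Real.sqrt_pos.2 (by norm_num)
  have hn : ∀ v : V n, ‖Real.sqrt 2 • v‖ = 1 ↔ 2 * ‖v‖ ^ 2 = 1 := fun v => by
    rw [← pow_eq_one_iff_of_nonneg (norm_nonneg _) two_ne_zero, norm_smul, mul_pow,
      Real.norm_eq_abs, sq_abs, h2]
  ext z
  rw [Set.mem_smul_set_iff_inv_smul_mem₀ (by positivity), one_div, inv_inv]
  simp only [levelSet, cliffordLevelSet, Set.mem_ofPred_eq, WithLp.smul_fst, WithLp.smul_snd, hn,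
    splittingForm_smul, cliffordForm_doubledSystem]
  have h4 : Real.sqrt 2 ^ 4 = 4 := by
    have : Real.sqrt 2 ^ 4 = (Real.sqrt 2 ^ 2) ^ 2 := by ring
    rw [this, h2]; norm_num
  have e1 : ‖z‖ ^ 2 = ‖z.fst‖ ^ 2 + ‖z.snd‖ ^ 2 := WithLp.prod_norm_sq_eq_of_L2 z
  have e2 : inner ℝ (reflOp n z) z = ‖z.fst‖ ^ 2 - ‖z.snd‖ ^ 2 := by
    rw [WithLp.prod_inner_apply]
    simp [inner_neg_left, sub_eq_add_neg]
  rw [e1, e2, h4]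
  constructor
  · rintro ⟨a, b, c⟩
    exact ⟨by linarith, by linarith, by linarith⟩
  · rintro ⟨a, b, c⟩
    exact ⟨by linarith, by linarith, by linarith⟩

theorem exists_unit_orthogonal_family {κ F : Type*} [Fintype κ] [NormedAddCommGroup F]
    [InnerProductSpace ℝ F] [FiniteDimensional ℝ F] (u : κ → F)
    (hκ : Fintype.card κ < Module.finrank ℝ F) : ∃ y : F, ‖y‖ = 1 ∧ ∀ i, inner ℝ (u i) y = 0 := by
  have hne : (Submodule.span ℝ (Set.range u))ᗮ ≠ ⊥ := by
    intro hbot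
    rw [Submodule.orthogonal_eq_bot_iff] at hbot
    have h1 := finrank_range_le_card (R := ℝ) u
    rw [Set.finrank, hbot, finrank_top] at h1
    omega
  obtain ⟨y, hy, hy0⟩ := Submodule.exists_mem_ne_zero_of_ne_bot hne
  refine ⟨‖y‖⁻¹ • y, by
    rw [norm_smul, norm_inv, norm_norm, inv_mul_cancel₀ (norm_ne_zero_iff.2 hy0)], fun i => ?_⟩
  rw [inner_smul_right, (Submodule.mem_orthogonal _ _).1 hy _ (Submodule.subset_span ⟨i, rfl⟩),
    mul_zero]

theorem IsSkewCliffordSystem.nonempty_levelSet (hA : IsSkewCliffordSystem A) (hr : r + 1 < n + 1)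
    {c : ℝ} (hc0 : 0 ≤ c) (hc1 : c ≤ 1) : (levelSet A c).Nonempty := by
  obtain ⟨x, hx, -⟩ := exists_unit_orthogonal_family (F := V n) (fun i : Fin 0 => (0 : V n))
    (by simp)
  obtain ⟨y, hy, hxy⟩ := exists_unit_orthogonal_family (fun i => withId A i x) (by simpa using hr)
  have hxy0 : inner ℝ x y = 0 := hxy none
  have hAx : ∀ q, inner ℝ (A q x) x = 0 := fun q => by
    have h1 := ContinuousLinearMap.adjoint_inner_left (A q) x x
    rw [hA.adjoint_apply, inner_neg_left, real_inner_comm] at h1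
    linarith [real_inner_comm x (A q x)]
  have hsc := Real.sq_sqrt hc0
  have hsc' := Real.sq_sqrt (sub_nonneg.2 hc1)
  refine ⟨WithLp.toLp 2 (x, Real.sqrt c • x + Real.sqrt (1 - c) • y), hx, ?_, ?_⟩
  · rw [← pow_eq_one_iff_of_nonneg (norm_nonneg _) two_ne_zero]
    simp only [WithLp.toLp_snd]
    rw [norm_add_sq_real, norm_smul, norm_smul, hx, hy, inner_smul_left, inner_smul_right, hxy0]
    simp [hsc, hsc']
  · have h1 : ∀ q, inner ℝ (A q x) y = 0 := fun q => hxy (some q)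
    simp [splittingForm, inner_add_right, inner_smul_right, hxy0, hAx, h1, hx, hsc]

end Doubling

end FKM

theorem proposition5p3 (n m : ℕ) (hm : 2 ≤ m) (hmn : m + 1 ≤ n)
    (A : Fin (m - 1) → FKM.V n →L[ℝ] FKM.V n) (hA : FKM.IsSkewCliffordSystem A) :
    FKM.scaledMinimalFKM A ⊆ FKM.unitSphere n ∧
      FKM.IsSubmanifoldOfCodim 3 (FKM.scaledMinimalFKM A) ∧
      IsLUB (FKM.sffNormSqValues (FKM.unitSphere n) (FKM.scaledMinimalFKM A))
        (6 * ((n : ℝ) - 1)) := by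
  have hm' : (2 : ℝ) ≤ m := by exact_mod_cast hm
  have hmn' : (m : ℝ) + 1 ≤ n := by exact_mod_cast hmn
  have hn1 : (0 : ℝ) < (n : ℝ) - 1 := by linarith
  set c : ℝ := ((m : ℝ) - 1) / ((n : ℝ) - 1) with hc
  have hcn : c * ((n : ℝ) - 1) = m - 1 := div_mul_cancel₀ _ hn1.ne'
  have hc0 : 0 < c := div_pos (by linarith) hn1
  have hc1 : c < 1 := (div_lt_one hn1).2 (by linarith)
  have hset : FKM.scaledMinimalFKM A
      = FKM.cliffordLevelSet (FKM.reflOp n) (FKM.doubledSystem A) (c / 4) :=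
    FKM.smul_levelSet_eq A c
  have h := hA.isSymmCliffordSystem
  have hpos : 0 < c / 4 * (1 - 4 * (c / 4)) := mul_pos (by linarith) (by linarith)
  have hs : Real.sqrt (c / 4 * (1 - 4 * (c / 4))) ≠ 0 := (Real.sqrt_pos.2 hpos).ne'
  have hsf := Real.sq_sqrt hpos.le
  have hdim : Module.finrank ℝ (FKM.W n) = 2 * (n + 1) := by
    rw [(WithLp.linearEquiv 2 ℝ (FKM.V n × FKM.V n)).finrank_eq, Module.finrank_prod,
      finrank_euclideanSpace_fin, two_mul]
  have hcard : (Fintype.card (Option (Fin (m - 1))) : ℝ) = m := by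
    rw [Fintype.card_option, Fintype.card_fin, Nat.sub_add_cancel (by omega)]
  refine ⟨?_, ?_, ?_⟩
  · rw [hset]
    intro z hz
    exact mem_sphere_zero_iff_norm.2
      ((pow_eq_one_iff_of_nonneg (norm_nonneg z) two_ne_zero).1 hz.1)
  · rw [hset]
    exact h.isSubmanifoldOfCodim hs hsf
  · have hne : (FKM.scaledMinimalFKM A).Nonempty :=
      (hA.nonempty_levelSet (by omega) hc0.le hc1.le).smul_set
    rw [hset] at hne ⊢
    have key := h.isLUB_sffNormSqValues hs hsf
      (by rw [hdim, hcard]; push_cast; linarith) (by omega) hne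
    have e : 6 * ((n : ℝ) - 1) = 3 * (Module.finrank ℝ (FKM.W n) - 4) := by
      rw [hdim]; push_cast; ring
    rw [e]
    exact key
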